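/- **Theorem 1.1.** For integers $N\ge 1$ and $j\ge 0$ let $s(N,j)$ be the (unsigned) Stirling number of the first kind, i.e. the number of permutations of $N$ elements with exactly $j$ disjoint cycles. For a prime $p$ let $v_p$ be the $p$-adic valuation, and let $\epsilon_k=1$ if $k$ is odd and $\epsilon_k=0$ if $k$ is even. Let $a\in\{1,2\}$ and let $n,m,k$ be integers with $1\le m\le n$, $2\le k\le 2a\,3^{m-1}+1$ and $k<a3^m$. Then $s(a3^n,a3^m-k)\neq 0$ and $$v_3\big(s(a3^n,a3^m-k)\big)=\frac a2(3^n-3^m)-(n-m)(a3^m-k)+m-1-v_3\Big(\Big\lfloor\frac k2\Big\rfloor\Big)+\big(m+v_3(k)\big)\epsilon_k .$$ Consequently the case $p=3$ of the following conjecture of Hong and Qiu is true. Conjecture, for an odd prime $p$: for all integers $a,n,m,k$ with $1\le a\le p-1$, $1\le m\le n$, $2\le k\le a(p-1)p^{m-1}+1$ and $k<ap^m$, one has $s(ap^n,ap^m-k)\ne 0$ and $$v_p\big(s(ap^n,ap^m-k)\big)=\frac a{p-1}(p^n-p^m)-(n-m)(ap^m-k)+m+\big(m+v_p(k)\big)\epsilon_k+T_k,$$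 where $T_k=-1-v_p(\lfloor k/2\rfloor)$ if $k\equiv\epsilon_k\pmod{p-1}$, and $T_k=v_p\big(B_{2\lfloor\langle k\rangle/2\rfloor}\big)$ otherwise; here $B_j$ is the $j$-th Bernoulli number and $\langle k\rangle$ is the integer with $0\le\langle k\rangle\le p-2$ and $k\equiv\langle k\rangle\pmod{p-1}$. -/

import Mathlib

/-- `parityBit k` is `ε_k`: it is `0` if `k` is even and `1` if `k` is odd. -/
def parityBit (k : ℕ) : ℕ := if Even k then 0 else 1

/-- The correction term `T_k` of the Hong--Qiu conjecture for the odd prime `p`: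
`-1 - v_p(⌊k/2⌋)` if `k ≡ ε_k (mod p - 1)`, and `v_p(B_{2⌊⟨k⟩/2⌋})` otherwise, where `B_j` is the
`j`-th Bernoulli number and `⟨k⟩ = k % (p - 1)` is the residue of `k` modulo `p - 1` in
`{0, …, p - 2}`. (Natural number division by `2` is the floor; Bernoulli numbers of even index
are nonzero, so `padicValRat` is the usual valuation there.) -/
def hongQiuTerm (p k : ℕ) : ℤ :=
  if k ≡ parityBit k [MOD (p - 1)] then
    -1 - (padicValNat p (k / 2) : ℤ)
  else
    padicValRat p (bernoulli (2 * ((k % (p - 1)) / 2)))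

/-- The Hong--Qiu conjecture for the odd prime `p`. Here `Nat.stirlingFirst N j` is the (unsigned)
Stirling number of the first kind, the number of permutations of `N` elements with `j` cycles;
it is asserted to be nonzero so that `padicValNat` is its genuine `p`-adic valuation. -/
def HongQiuConjecture (p : ℕ) : Prop :=
  ∀ a n m k : ℕ, 1 ≤ a → a ≤ p - 1 → 1 ≤ m → m ≤ n →
    2 ≤ k → k ≤ a * (p - 1) * p ^ (m - 1) + 1 → k < a * p ^ m →
    Nat.stirlingFirst (a * p ^ n) (a * p ^ m - k) ≠ 0 ∧
    (padicValNat p (Nat.stirlingFirst (a * p ^ n) (a * p ^ m - k)) : ℚ) =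
      (a : ℚ) / ((p : ℚ) - 1) * ((p : ℚ) ^ n - (p : ℚ) ^ m)
        - ((n : ℚ) - (m : ℚ)) * ((a : ℚ) * (p : ℚ) ^ m - (k : ℚ))
        + (m : ℚ) + ((m : ℚ) + (padicValNat p k : ℚ)) * (parityBit k : ℚ)
        + (hongQiuTerm p k : ℚ)

/-! Dropping from `∏_{i < 3D} (x + i y)` the factors with `3 ∣ i` leaves `homRisingUnits`, which for
`D = a 3^M` is `(x² - y²)^D` modulo `3^(M+1)`. For even `k` and `n = m = M + 1`, set `x = 1`, `y =
X`: weighting by `k` makes `k s(a 3^m, a 3^m - k)` congruent modulo `3^m` to `k` times the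
coefficient of `X^k` in `(1 - X²)^D`. For `0 < k ≤ 2D` this has valuation exactly `M`, by Lucas
(`three_pow_dvd_mul_stirlingFirst`). For `n = m + r`, set `x = 3^r X`, `y = 1`: the extra unit
factors become constants `±1` modulo `3^m`, so only an explicit power of 3 enters
(`exists_scaled_stirlingFirst`). For odd `k`, the symmetry `X ↦ -X - N` of `∏_{0 < i < N} (X + i)`
reduces to the even number `k - 1` (`three_pow_dvd_two_mul_scaled_sub`). -/

open Polynomial Finset

/-! ### Rising factorials modulo powers of 3 -/

/-- The homogeneous rising factorial `x (x + y) ⋯ (x + (N - 1) y)`. -/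
def homRising {R : Type*} [CommRing R] (N : ℕ) (x y : R) : R :=
  ∏ i ∈ range N, (x + (i : R) * y)

/-- The product of the factors `x + u y` of `homRising (3 * D) x y` with `u` prime to `3`. -/
def homRisingUnits {R : Type*} [CommRing R] (D : ℕ) (x y : R) : R :=
  ∏ i ∈ range D, ((x + (3 * (i : R) + 1) * y) * (x + (3 * (i : R) + 2) * y))

section HomRising

variable {R : Type*} [CommRing R]

lemma homRising_three_mul (D : ℕ) (x y : R) :
    homRising (3 * D) x y = homRising D x (3 * y) * homRisingUnits D x y := by
  induction D with
  | zero => simp [homRising, homRisingUnits]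
  | succ D ih =>
    simp only [homRising, homRisingUnits] at ih ⊢
    rw [show 3 * (D + 1) = 3 * D + 1 + 1 + 1 by ring, prod_range_succ, prod_range_succ,
      prod_range_succ, ih, prod_range_succ, prod_range_succ]
    push_cast
    ring

lemma homRising_mul_mul (N : ℕ) (c x y : R) :
    homRising N (c * x) (c * y) = c ^ N * homRising N x y := by
  simp only [homRising]
  rw [← card_range N, ← prod_const, card_range, ← prod_mul_distrib]
  exact prod_congr rfl fun i _ => by ring

lemma map_homRising {S : Type*} [CommRing S] (f : R →+* S) (N : ℕ) (x y : R) :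
    f (homRising N x y) = homRising N (f x) (f y) := by
  simp [homRising]

lemma homRisingUnits_add (D E : ℕ) (x y : R) :
    homRisingUnits (D + E) x y =
      homRisingUnits D x y * homRisingUnits E (x + ((3 * D : ℕ) : R) * y) y := by
  simp only [homRisingUnits, prod_range_add]
  congr 1
  exact prod_congr rfl fun i _ => by push_cast; ring

lemma homRisingUnits_eq_eval (D : ℕ) (y : R) :
    ∃ f : R[X], ∀ x, homRisingUnits D x y = f.eval x :=
  ⟨∏ i ∈ range D, ((X + C ((3 * (i : R) + 1) * y)) * (X + C ((3 * (i : R) + 2) * y))),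
    fun x => by simp [homRisingUnits, eval_prod]⟩

/-- Passing from `M` to `M + 1` multiplies three blocks with `x` shifted by `0`, `h`, `2h`, where `h
= 3^(M+1) y`. The first-order terms add up to `3h`, gaining a factor 3, and cubing the inductive
congruence gains one as well. -/
lemma three_pow_dvd_homRisingUnits_sub (M : ℕ) (x y : R) :
    (3 : R) ^ (M + 1) ∣ homRisingUnits (3 ^ M) x y - (x ^ 2 - y ^ 2) ^ 3 ^ M := by
  induction M with
  | zero => exact ⟨(x + y) * y, by simp [homRisingUnits]; ring⟩
  | succ M ih =>
    obtain ⟨f, hf⟩ := homRisingUnits_eq_eval (3 ^ M) y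
    obtain ⟨k₁, hk₁⟩ := f.binomExpansion x (3 ^ (M + 1) * y)
    obtain ⟨k₂, hk₂⟩ := f.binomExpansion x (2 * (3 ^ (M + 1) * y))
    have hsplit : homRisingUnits (3 ^ (M + 1)) x y =
        f.eval x * f.eval (x + 3 ^ (M + 1) * y) * f.eval (x + 2 * (3 ^ (M + 1) * y)) := by
      rw [show 3 ^ (M + 1) = 3 ^ M + 3 ^ M + 3 ^ M by ring, homRisingUnits_add,
        homRisingUnits_add, hf, hf, hf]
      congr 2 <;> congr 1 <;> push_cast <;> ring
    obtain ⟨z, hz⟩ := ih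
    rw [hf] at hz
    have hA : f.eval x = (x ^ 2 - y ^ 2) ^ 3 ^ M + 3 ^ (M + 1) * z := by
      rw [← hz]; ring
    have h1 : (3 : R) ^ (M + 2) ∣ homRisingUnits (3 ^ (M + 1)) x y - f.eval x ^ 3 := by
      rw [hsplit, hk₁, hk₂]
      generalize f.eval x = A
      generalize f.derivative.eval x = B
      refine ⟨y * A ^ 2 * B + 3 ^ M * y ^ 2 * (A ^ 2 * (k₁ + 4 * k₂) + 2 * A * B ^ 2)
        + 3 ^ M * 3 ^ (M + 1) * y ^ 3 * (A * B * (4 * k₂ + 2 * k₁))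
        + 3 ^ M * 3 ^ (M + 1) * 3 ^ (M + 1) * y ^ 4 * (4 * A * k₁ * k₂), ?_⟩
      ring
    have h2 : (3 : R) ^ (M + 2) ∣ f.eval x ^ 3 - (x ^ 2 - y ^ 2) ^ 3 ^ (M + 1) := by
      rw [pow_succ 3 M, pow_mul, hA]
      generalize (x ^ 2 - y ^ 2) ^ 3 ^ M = B
      refine ⟨B ^ 2 * z + 3 ^ (M + 1) * B * z ^ 2 + 3 ^ (2 * M + 1) * z ^ 3, ?_⟩
      ring
    have := dvd_add h1 h2
    rwa [sub_add_sub_cancel] at this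

lemma three_pow_dvd_homRisingUnits_mul_sub (a M : ℕ) (x y : R) :
    (3 : R) ^ (M + 1) ∣ homRisingUnits (a * 3 ^ M) x y - (x ^ 2 - y ^ 2) ^ (a * 3 ^ M) := by
  induction a with
  | zero => simp [homRisingUnits]
  | succ a ih =>
    have h1 := three_pow_dvd_homRisingUnits_sub M (x + ((3 * (a * 3 ^ M) : ℕ) : R) * y) y
    have h2 : (3 : R) ^ (M + 1) ∣
        ((x + ((3 * (a * 3 ^ M) : ℕ) : R) * y) ^ 2 - y ^ 2) ^ 3 ^ M - (x ^ 2 - y ^ 2) ^ 3 ^ M := by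
      refine dvd_trans ?_ (sub_dvd_pow_sub_pow _ _ _)
      refine ⟨2 * a * x * y + a * (3 * (a * 3 ^ M) : ℕ) * y ^ 2, ?_⟩
      push_cast
      ring
    have h3 := dvd_add h1 h2
    rw [sub_add_sub_cancel] at h3
    rw [add_mul, one_mul, homRisingUnits_add, pow_add (x ^ 2 - y ^ 2)]
    convert dvd_add (ih.mul_right (homRisingUnits (3 ^ M) (x + ((3 * (a * 3 ^ M) : ℕ) : R) * y) y))
      (h3.mul_left ((x ^ 2 - y ^ 2) ^ (a * 3 ^ M))) using 1
    ring

end HomRising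

/-! ### Stirling numbers as coefficients -/

lemma coeff_homRising_X_one (N j : ℕ) :
    (homRising N (X : ℤ[X]) 1).coeff j = Nat.stirlingFirst N j := by
  induction N generalizing j with
  | zero => cases j <;> simp [homRising, Polynomial.coeff_one]
  | succ N ih =>
    have h : homRising (N + 1) (X : ℤ[X]) 1 =
        homRising N X 1 * X + C (N : ℤ) * homRising N X 1 := by
      simp only [homRising, prod_range_succ, map_natCast]
      ring
    rw [h, coeff_add, coeff_C_mul, ih]
    cases j with
    | zero => cases N <;> simp
    | succ j => rw [coeff_mul_X, ih, Nat.stirlingFirst_succ_succ]; push_cast; ring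

lemma homRising_succ_one_X (N : ℕ) :
    homRising (N + 1) (1 : ℤ[X]) X = homRising N 1 X + C (N : ℤ) * homRising N 1 X * X := by
  simp only [homRising, prod_range_succ, map_natCast]
  ring

lemma coeff_homRising_one_X_of_lt {N k : ℕ} (h : N < k) :
    (homRising N (1 : ℤ[X]) X).coeff k = 0 := by
  induction N generalizing k with
  | zero => simp [homRising, Polynomial.coeff_one, h.ne']
  | succ N ih =>
    obtain ⟨k, rfl⟩ : ∃ l, k = l + 1 := ⟨k - 1, by lia⟩
    rw [homRising_succ_one_X, coeff_add, coeff_mul_X, coeff_C_mul, ih (by lia), ih (by lia)]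
    simp

lemma coeff_homRising_one_X {N j k : ℕ} (h : j + k = N) :
    (homRising N (1 : ℤ[X]) X).coeff k = Nat.stirlingFirst N j := by
  induction N generalizing j k with
  | zero =>
    obtain ⟨rfl, rfl⟩ : j = 0 ∧ k = 0 := by lia
    simp [homRising]
  | succ N ih =>
    rw [homRising_succ_one_X, coeff_add]
    cases k with
    | zero =>
      obtain ⟨rfl⟩ : j = N + 1 := by lia
      rw [ih (j := N) (by lia)]
      simp [Nat.stirlingFirst_self]
    | succ k =>
      rw [coeff_mul_X, coeff_C_mul, ih (j := j) (k := k) (by lia)]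
      cases j with
      | zero =>
        rw [coeff_homRising_one_X_of_lt (by lia)]
        cases N <;> simp
      | succ j =>
        rw [ih (j := j) (by lia), Nat.stirlingFirst_succ_succ]
        push_cast
        ring

lemma coeff_homRising_one_mul_X (c : ℤ) (N k : ℕ) :
    (homRising N (1 : ℤ[X]) (C c * X)).coeff k = c ^ k * (homRising N 1 X).coeff k := by
  have h : homRising N (1 : ℤ[X]) (C c * X) = (homRising N 1 X).comp (C c * X) := by
    have := map_homRising (compRingHom (C c * X : ℤ[X])) N 1 X
    simpa using this.symm
  rw [h, comp_C_mul_X_coeff, mul_comm]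

lemma three_pow_dvd_coeff_of_dvd {p : ℤ[X]} {M : ℕ} (h : (3 : ℤ[X]) ^ M ∣ p) (k : ℕ) :
    (3 : ℤ) ^ M ∣ p.coeff k := by
  have h' : C ((3 : ℤ) ^ M) ∣ p := by simpa using h
  exact (C_dvd_iff_dvd_coeff _ _).1 h' k

/-! ### Even `k` with `n = m` -/

lemma dvd_mul_coeff_one_sub_X_sq_pow (D k : ℕ) :
    (D : ℤ) ∣ k * ((1 - X ^ 2 : ℤ[X]) ^ D).coeff k := by
  cases k with
  | zero => simp
  | succ k =>
    have h := coeff_derivative ((1 - X ^ 2 : ℤ[X]) ^ D) k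
    rw [derivative_pow] at h
    rw [mul_comm]
    push_cast
    rw [← h, mul_assoc, coeff_C_mul]
    exact dvd_mul_right _ _

lemma one_sub_X_sq_pow_eq_expand (D : ℕ) :
    (1 - X ^ 2 : ℤ[X]) ^ D = expand ℤ 2 ((1 - X) ^ D) := by
  simp

lemma coeff_one_sub_X_sq_pow_of_odd (D : ℕ) {k : ℕ} (hk : Odd k) :
    ((1 - X ^ 2 : ℤ[X]) ^ D).coeff k = 0 := by
  rw [one_sub_X_sq_pow_eq_expand, coeff_expand two_pos, if_neg]
  rwa [← even_iff_two_dvd, Nat.not_even_iff_odd]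

lemma coeff_one_sub_X_pow (D t : ℕ) :
    ((1 - X : ℤ[X]) ^ D).coeff t = (-1) ^ t * D.choose t := by
  have h : (1 - X : ℤ[X]) ^ D = ((1 + X) ^ D).comp (C (-1) * X) := by
    simp [sub_eq_add_neg]
  rw [h, comp_C_mul_X_coeff, coeff_one_add_X_pow, mul_comm]

lemma coeff_one_sub_X_sq_pow_two_mul (D t : ℕ) :
    ((1 - X ^ 2 : ℤ[X]) ^ D).coeff (2 * t) = (-1) ^ t * D.choose t := by
  rw [one_sub_X_sq_pow_eq_expand, coeff_expand_mul' two_pos, coeff_one_sub_X_pow]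

/-- The hypothesis is a weak bound at level `M`; the conclusion returns it at level `M + 1`, which
drives the induction in `three_pow_dvd_three_mul_coeff`. -/
lemma three_pow_dvd_mul_coeff_sub {a M : ℕ}
    (h : ∀ i, Even i → (3 : ℤ) ^ M ∣ 3 * (i * (homRising (a * 3 ^ M) (1 : ℤ[X]) X).coeff i))
    {k : ℕ} (hk : Even k) :
    (3 : ℤ) ^ (M + 1) ∣ k * (homRising (a * 3 ^ (M + 1)) (1 : ℤ[X]) X).coeff k -
      k * ((1 - X ^ 2 : ℤ[X]) ^ (a * 3 ^ M)).coeff k := by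
  set D := a * 3 ^ M with hD
  set Q := (1 - X ^ 2 : ℤ[X]) ^ D with hQ
  set P := homRising D (1 : ℤ[X]) (C 3 * X) with hP
  have hDM : (3 : ℤ) ^ M ∣ D := ⟨a, by rw [hD]; push_cast; ring⟩
  have h1 : (3 : ℤ) ^ (M + 1) ∣ (homRising (a * 3 ^ (M + 1)) (1 : ℤ[X]) X).coeff k -
      (P * Q).coeff k := by
    rw [← coeff_sub]
    refine three_pow_dvd_coeff_of_dvd ?_ k
    have := three_pow_dvd_homRisingUnits_mul_sub a M (1 : ℤ[X]) X
    rw [show a * 3 ^ (M + 1) = 3 * D by rw [hD]; ring, homRising_three_mul,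
      show (3 : ℤ[X]) * X = C 3 * X by simp, ← mul_sub]
    rw [one_pow] at this
    exact this.mul_left _
  have h2 : (3 : ℤ) ^ (M + 1) ∣ k * (P * Q).coeff k - k * Q.coeff k := by
    have : (k : ℤ) * (P * Q).coeff k - k * Q.coeff k = k * ((P - 1) * Q).coeff k := by
      rw [sub_mul, one_mul, coeff_sub, mul_sub]
    rw [this, coeff_mul, mul_sum]
    refine dvd_sum fun ⟨i, l⟩ hil => ?_
    have hil : i + l = k := by simpa using hil
    rw [coeff_sub, hP, coeff_homRising_one_mul_X]
    rcases Nat.eq_zero_or_pos i with rfl | hi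
    · rw [coeff_homRising_one_X (j := D) (by simp)]
      simp [Nat.stirlingFirst_self]
    rcases Nat.even_or_odd i with hie | hio
    · have hi2 : 2 ≤ i := by
        obtain ⟨c, rfl⟩ := hie
        lia
      obtain ⟨b, rfl⟩ : ∃ b, i = b + 2 := ⟨i - 2, by lia⟩
      obtain ⟨u, hu⟩ := h _ hie
      obtain ⟨v, hv⟩ := hDM.trans (dvd_mul_coeff_one_sub_X_sq_pow D l)
      rw [← hQ] at hv
      rw [coeff_one, if_neg (by lia), sub_zero, ← hil]
      -- The weight splits as `k = i + l`: the `i` part uses `h`, with one of the factors `3^i`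
      -- spent on its 3, and the `l` part uses the divisibility of `l * Q.coeff l` by `D`.
      refine ⟨3 ^ b * u * Q.coeff l +
        3 ^ (b + 1) * v * (homRising D (1 : ℤ[X]) X).coeff (b + 2), ?_⟩
      generalize (homRising D (1 : ℤ[X]) X).coeff (b + 2) = w at *
      push_cast at hu ⊢
      linear_combination (3 ^ (b + 1) * Q.coeff l) * hu + (3 ^ (b + 2) * w) * hv
    · rw [hQ, coeff_one_sub_X_sq_pow_of_odd]
      · simp
      · rw [← hil] at hk
        exact (Nat.even_add'.1 hk).1 hio
  have h3 := dvd_add (h1.mul_left (k : ℤ)) h2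
  rwa [mul_sub, sub_add_sub_cancel] at h3

lemma three_pow_dvd_three_mul_coeff (a M : ℕ) {i : ℕ} (hi : Even i) :
    (3 : ℤ) ^ M ∣ 3 * (i * (homRising (a * 3 ^ M) (1 : ℤ[X]) X).coeff i) := by
  induction M generalizing i with
  | zero => simp
  | succ M ih =>
    have h1 := (pow_dvd_pow (3 : ℤ) (Nat.le_succ M)).trans
      (three_pow_dvd_mul_coeff_sub (fun i hi => ih hi) hi)
    have h2 : (3 : ℤ) ^ M ∣ i * ((1 - X ^ 2 : ℤ[X]) ^ (a * 3 ^ M)).coeff i :=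
      Dvd.dvd.trans ⟨a, by push_cast; ring⟩ (dvd_mul_coeff_one_sub_X_sq_pow (a * 3 ^ M) i)
    rw [pow_succ']
    exact mul_dvd_mul_left 3 ((dvd_sub_left h2).1 h1)

/-- All base 3 digits of `a 3^M - 1` below the top one are 2, and `C(2, d)` is prime to 3 for every
digit `d`; Lucas then applies. -/
lemma not_three_dvd_choose {a : ℕ} (ha : a = 1 ∨ a = 2) (M : ℕ) {t : ℕ} (ht : t < a * 3 ^ M) :
    ¬ 3 ∣ (a * 3 ^ M - 1).choose t := by
  induction M generalizing t with
  | zero =>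
    rcases ha with rfl | rfl
    · obtain rfl : t = 0 := by lia
      simp
    · have : t = 0 ∨ t = 1 := by lia
      rcases this with rfl | rfl <;> simp
  | succ M ih =>
    have : Fact (Nat.Prime 3) := ⟨Nat.prime_three⟩
    have hpos : 0 < a * 3 ^ M := by
      rcases ha with rfl | rfl <;> positivity
    have hN : a * 3 ^ (M + 1) = 3 * (a * 3 ^ M) := by ring
    rw [hN] at ht ⊢
    have h := Choose.choose_modEq_choose_mod_mul_choose_div_nat
      (n := 3 * (a * 3 ^ M) - 1) (k := t) (p := 3)
    rw [show (3 * (a * 3 ^ M) - 1) % 3 = 2 by lia,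
      show (3 * (a * 3 ^ M) - 1) / 3 = a * 3 ^ M - 1 by lia] at h
    rw [(h.dvd_iff (dvd_refl 3)), Nat.prime_three.dvd_mul, not_or]
    refine ⟨?_, ih (by lia)⟩
    have : t % 3 < 3 := Nat.mod_lt _ (by norm_num)
    interval_cases t % 3 <;> decide

lemma three_pow_dvd_mul_stirlingFirst {a : ℕ} (ha : a = 1 ∨ a = 2) (M : ℕ) {j k : ℕ}
    (hk : Even k) (hk0 : 0 < k) (hk2 : k ≤ 2 * (a * 3 ^ M)) (hjk : j + k = a * 3 ^ (M + 1)) :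
    (3 : ℤ) ^ M ∣ k * Nat.stirlingFirst (a * 3 ^ (M + 1)) j ∧
      ¬ (3 : ℤ) ^ (M + 1) ∣ k * Nat.stirlingFirst (a * 3 ^ (M + 1)) j := by
  have h := three_pow_dvd_mul_coeff_sub (fun i hi => three_pow_dvd_three_mul_coeff a M hi) hk
  rw [coeff_homRising_one_X hjk] at h
  obtain ⟨t, rfl⟩ := even_iff_two_dvd.1 hk
  obtain ⟨t, rfl⟩ : ∃ b, t = b + 1 := ⟨t - 1, by lia⟩
  obtain ⟨D, hD⟩ : ∃ D, a * 3 ^ M = D + 1 := ⟨a * 3 ^ M - 1, by lia⟩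
  have hc := not_three_dvd_choose ha M (t := t) (by lia)
  rw [hD, coeff_one_sub_X_sq_pow_two_mul] at h
  rw [hD, Nat.add_sub_cancel] at hc
  -- Absorption `(t+1) C(D+1, t+1) = (D+1) C(D, t)`, with `D + 1 = a 3^M`, isolates the exact power
  -- of 3.
  have hq : ((2 * (t + 1) : ℕ) : ℤ) * ((-1) ^ (t + 1) * ((D + 1).choose (t + 1) : ℤ)) =
      3 ^ M * ((-1) ^ (t + 1) * (2 * a * (D.choose t : ℤ))) := by
    have h1 : ((D : ℤ) + 1) * D.choose t = (D + 1).choose (t + 1) * (t + 1) := by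
      exact_mod_cast Nat.add_one_mul_choose_eq D t
    have h2 : (a : ℤ) * 3 ^ M = D + 1 := by exact_mod_cast hD
    push_cast
    linear_combination (-2) * (-1) ^ (t + 1) * h1 - 2 * (-1) ^ (t + 1) * (D.choose t : ℤ) * h2
  rw [hq] at h
  constructor
  · exact (dvd_sub_left (dvd_mul_right _ _)).1 ((pow_dvd_pow (3 : ℤ) (Nat.le_succ M)).trans h)
  · intro h'
    rw [dvd_sub_right h', pow_succ, mul_dvd_mul_iff_left (by positivity),
      (isUnit_one.neg.pow _).dvd_mul_left] at h
    have : 3 ∣ 2 * a * D.choose t := by exact_mod_cast h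
    rcases (Nat.prime_three.dvd_mul).1 this with h | h
    · rcases ha with rfl | rfl <;> revert h <;> decide
    · exact hc h

/-! ### From `a 3^m` to `a 3^(m + r)` -/

lemma three_pow_dvd_homRisingUnits_sub_const (a M : ℕ) (z : ℤ[X]) :
    (3 : ℤ[X]) ^ (M + 1) ∣ homRisingUnits (a * 3 ^ M) (3 * z) 1 - (-1) ^ (a * 3 ^ M) := by
  have h1 := three_pow_dvd_homRisingUnits_mul_sub a M (3 * z) 1
  have h2 : (3 : ℤ[X]) ^ (M + 1) ∣ ((3 * z) ^ 2 - 1 ^ 2) ^ 3 ^ M - (-1) ^ 3 ^ M := by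
    have : ((3 : ℕ) : ℤ[X]) ∣ ((3 * z) ^ 2 - 1 ^ 2) - (-1) := ⟨3 * z ^ 2, by push_cast; ring⟩
    exact_mod_cast dvd_sub_pow_of_dvd_sub this M
  have h3 := h2.trans (sub_dvd_pow_sub_pow _ _ a)
  rw [← pow_mul, ← pow_mul, mul_comm (3 ^ M) a] at h3
  have := dvd_add h1 h3
  rwa [sub_add_sub_cancel] at this

lemma exists_homRising_scaled_eq (a m r : ℕ) :
    ∃ (c : ℕ) (e : ℤ) (H : ℤ[X]), 2 * c + a * 3 ^ m = a * 3 ^ (m + r) ∧ IsUnit e ∧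
      homRising (a * 3 ^ (m + r)) ((3 : ℤ[X]) ^ r * X) 1 =
        3 ^ c * homRising (a * 3 ^ m) X 1 * H ∧ (3 : ℤ[X]) ^ m ∣ H - C e := by
  induction r with
  | zero => exact ⟨0, 1, 1, by simp, isUnit_one, by simp, by simp⟩
  | succ r ih =>
    obtain ⟨c, e, H, hc, he, hH, hdvd⟩ := ih
    set D := a * 3 ^ (m + r) with hD
    -- Each tripling extracts `3^D` from the factors with index divisible by 3; the sum of these
    -- exponents is `c = a (3^(m+r) - 3^m) / 2`.
    refine ⟨D + c, (-1) ^ D * e, homRisingUnits D (3 * (3 ^ r * X)) 1 * H, ?_,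
      (isUnit_one.neg.pow _).mul he, ?_, ?_⟩
    · rw [← add_assoc m, pow_succ]
      lia
    · rw [show a * 3 ^ (m + (r + 1)) = 3 * D by rw [hD]; ring, homRising_three_mul,
        show (3 : ℤ[X]) ^ (r + 1) * X = 3 * (3 ^ r * X) by ring, homRising_mul_mul, hH]
      ring
    · have h1 : (3 : ℤ[X]) ^ m ∣ homRisingUnits D (3 * (3 ^ r * X)) 1 - (-1) ^ D :=
        (pow_dvd_pow _ (by lia)).trans
          (three_pow_dvd_homRisingUnits_sub_const a (m + r) (3 ^ r * X))
      convert dvd_add (h1.mul_right H) (hdvd.mul_left ((-1) ^ D)) using 1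
      simp
      ring

/-- The Stirling numbers `s(a 3 ^ (m + r), j)` are, up to explicit powers of `3`, congruent to
`± s(a 3 ^ m, j)` modulo `3 ^ m`. -/
lemma exists_scaled_stirlingFirst (a m r : ℕ) :
    ∃ (c : ℕ) (e : ℤ) (w : ℕ → ℤ), 2 * c + a * 3 ^ m = a * 3 ^ (m + r) ∧ IsUnit e ∧
      ∀ j, 3 ^ (r * j) * (Nat.stirlingFirst (a * 3 ^ (m + r)) j : ℤ) = 3 ^ c * w j ∧
        (3 : ℤ) ^ m ∣ w j - e * Nat.stirlingFirst (a * 3 ^ m) j := by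
  obtain ⟨c, e, H, hc, he, hH, hdvd⟩ := exists_homRising_scaled_eq a m r
  refine ⟨c, e, fun j => (homRising (a * 3 ^ m) X 1 * H).coeff j, hc, he, fun j => ⟨?_, ?_⟩⟩
  · have h : homRising (a * 3 ^ (m + r)) ((3 : ℤ[X]) ^ r * X) 1 =
        (homRising (a * 3 ^ (m + r)) X 1).comp (C (3 ^ r) * X) := by
      have := map_homRising (compRingHom (C (3 ^ r) * X : ℤ[X])) (a * 3 ^ (m + r)) X 1
      simpa using this.symm
    have h' := congrArg (fun p => coeff p j) (h.symm.trans hH)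
    simp only [comp_C_mul_X_coeff, coeff_homRising_X_one] at h'
    rw [mul_comm, pow_mul, h', mul_assoc, show (3 : ℤ[X]) ^ c = C (3 ^ c) by simp, coeff_C_mul]
  · have h : homRising (a * 3 ^ m) X 1 * (H - C e) =
        homRising (a * 3 ^ m) X 1 * H - C e * homRising (a * 3 ^ m) X 1 := by ring
    have h' := three_pow_dvd_coeff_of_dvd (hdvd.mul_left (homRising (a * 3 ^ m) X 1)) j
    rwa [h, coeff_sub, coeff_C_mul, coeff_homRising_X_one] at h'

/-! ### Reflection symmetry, for odd `k` -/

lemma coeff_prod_X_add_succ (L j : ℕ) :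
    (∏ i ∈ range L, (X + ((i : ℤ[X]) + 1))).coeff j =
      (Nat.stirlingFirst (L + 1) (j + 1) : ℤ) := by
  rw [← coeff_homRising_X_one, homRising, prod_range_succ']
  simp

lemma natDegree_prod_X_add_succ_comp_neg_X (L : ℕ) :
    ((∏ i ∈ range L, (X + ((i : ℤ[X]) + 1))).comp (C (-1) * X)).natDegree ≤ L := by
  rw [natDegree_le_iff_coeff_eq_zero]
  intro j hj
  rw [comp_C_mul_X_coeff, coeff_prod_X_add_succ, Nat.stirlingFirst_eq_zero_of_lt (by lia)]
  simp

lemma taylor_prod_X_add_succ (L : ℕ) :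
    taylor ((L : ℤ) + 1) ((∏ i ∈ range L, (X + ((i : ℤ[X]) + 1))).comp (C (-1) * X)) =
      (-1) ^ L * ∏ i ∈ range L, (X + ((i : ℤ[X]) + 1)) := by
  rw [taylor_apply, Polynomial.prod_comp, Polynomial.prod_comp, ← prod_range_reflect]
  conv_rhs => rw [← card_range L, ← prod_const, card_range, ← prod_mul_distrib]
  refine prod_congr rfl fun i hi => ?_
  have hi : i < L := by simpa using hi
  obtain ⟨b, rfl⟩ : ∃ b, L = i + 1 + b := ⟨L - (i + 1), by lia⟩
  rw [show i + 1 + b - 1 - i = b by lia]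
  simp
  ring

/-- The relation between Stirling numbers expressing the symmetry of the rising factorial. -/
lemma neg_one_pow_mul_stirlingFirst (L j : ℕ) :
    (-1 : ℤ) ^ L * Nat.stirlingFirst (L + 1) (j + 1) = ∑ i ∈ range (L + 1),
      (-1) ^ (i + j) * ((i + j).choose j * Nat.stirlingFirst (L + 1) (j + 1 + i) *
        ((L : ℤ) + 1) ^ i) := by
  have h := congrArg (fun p => coeff p j) (taylor_prod_X_add_succ L)
  have hC : (-1 : ℤ[X]) ^ L = C ((-1) ^ L) := by simp
  simp only [taylor_coeff] at h
  rw [hC, coeff_C_mul, coeff_prod_X_add_succ] at h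
  rw [← h, eval_eq_sum_range' (n := L + 1)]
  · refine sum_congr rfl fun i _ => ?_
    rw [hasseDeriv_coeff, comp_C_mul_X_coeff, coeff_prod_X_add_succ,
      show j + 1 + i = i + j + 1 by ring]
    ring
  · have := natDegree_hasseDeriv_le
      ((∏ i ∈ range L, (X + ((i : ℤ[X]) + 1))).comp (C (-1) * X)) j
    have := natDegree_prod_X_add_succ_comp_neg_X L
    lia

/-- From `i C(i+j, j) = (j+1) C(i+j, j+1)`, the binomial loses at most `v_3(i)` from `e`, and
`v_3(i) ≤ i - 2` for `i ≥ 2`. -/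
lemma three_pow_dvd_choose_mul {m e i j : ℕ} (hm : 1 ≤ m) (hi : 2 ≤ i) (he : 3 ^ e ∣ j + 1) :
    3 ^ (2 * m + e) ∣ (i + j).choose j * (3 ^ m) ^ i := by
  have : Fact (Nat.Prime 3) := ⟨Nat.prime_three⟩
  have hch : (i + j).choose j ≠ 0 := (Nat.choose_pos (by lia)).ne'
  have hch' : (i + j).choose (j + 1) ≠ 0 := (Nat.choose_pos (by lia)).ne'
  have h := Nat.choose_succ_right_eq (i + j) j
  rw [Nat.add_sub_cancel] at h
  have hv := congrArg (padicValNat 3) h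
  rw [padicValNat.mul hch' (by lia), padicValNat.mul hch (by lia)] at hv
  have he' : e ≤ padicValNat 3 (j + 1) := (padicValNat_dvd_iff_le (by lia)).1 he
  have hvi : padicValNat 3 i + 2 ≤ i := by
    have hle : 3 ^ padicValNat 3 i ≤ i := Nat.le_of_dvd (by lia) pow_padicValNat_dvd
    have hpow : ∀ f : ℕ, 1 ≤ f → f + 2 ≤ 3 ^ f := fun f hf => by
      induction f, hf using Nat.le_induction with
      | base => norm_num
      | succ f _ ih => rw [pow_succ]; lia
    rcases Nat.eq_zero_or_pos (padicValNat 3 i) with h0 | h0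
    · lia
    · exact (hpow _ h0).trans hle
  rw [padicValNat_dvd_iff_le (by positivity), padicValNat.mul hch (by positivity), ← pow_mul,
    padicValNat.prime_pow]
  obtain ⟨b, rfl⟩ : ∃ b, i = b + 2 := ⟨i - 2, by lia⟩
  have hmb := Nat.mul_le_mul_right b hm
  rw [mul_add]
  lia

/-- In the rescaled symmetry relation the terms with `i ≥ 2` vanish modulo `3^(2m+e)`. By the parity
hypothesis the `i = 0` term adds to the left side instead of cancelling it, whence the 2. -/
lemma three_pow_dvd_two_mul_scaled_sub {a m r c j e : ℕ} {w : ℕ → ℤ} (hm : 1 ≤ m) (ha : 1 ≤ a)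
    (hw : ∀ j, 3 ^ (r * j) * (Nat.stirlingFirst (a * 3 ^ (m + r)) j : ℤ) = 3 ^ c * w j)
    (hodd : Odd (a * 3 ^ (m + r) + (j + 1))) (he : 3 ^ e ∣ j + 1) :
    (3 : ℤ) ^ (2 * m + e) ∣ 2 * w (j + 1) - (j + 1) * (a * 3 ^ m) * w (j + 2) := by
  have h3 : 3 ≤ 3 ^ (m + r) := by
    calc 3 = 3 ^ 1 := by norm_num
      _ ≤ _ := Nat.pow_le_pow_right (by norm_num) (by lia)
  obtain ⟨L, hL⟩ : ∃ L, a * 3 ^ (m + r) = L + 1 + 1 := ⟨a * 3 ^ (m + r) - 2, by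
    have := Nat.mul_le_mul ha h3
    lia⟩
  have hLa : ((L + 1 : ℕ) : ℤ) + 1 = a * 3 ^ (m + r) := by exact_mod_cast hL.symm
  have hs := neg_one_pow_mul_stirlingFirst (L + 1) j
  rw [hLa, ← hL] at hs
  have hsw : (-1 : ℤ) ^ (L + 1) * w (j + 1) = ∑ i ∈ range (a * 3 ^ (m + r)),
      (-1) ^ (i + j) * ((i + j).choose j * w (j + 1 + i) * (a * 3 ^ m) ^ i) := by
    have hc : (3 : ℤ) ^ c ≠ 0 := by positivity
    refine mul_left_cancel₀ hc ?_
    have := congrArg (fun x => 3 ^ (r * (j + 1)) * x) hs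
    simp only [mul_sum] at this ⊢
    calc _ = (-1) ^ (L + 1) * (3 ^ c * w (j + 1)) := by ring
      _ = _ := by rw [← hw, mul_left_comm, this]
      _ = _ := sum_congr rfl fun i _ => by
        calc _ = (-1) ^ (i + j) * ((i + j).choose j * (3 ^ (r * (j + 1 + i)) *
              (Nat.stirlingFirst (a * 3 ^ (m + r)) (j + 1 + i) : ℤ)) * (a * 3 ^ m) ^ i) := by
              ring
          _ = _ := by rw [hw]; ring
  rw [hL, sum_range_succ', sum_range_succ'] at hsw
  set S := ∑ i ∈ range L, (-1 : ℤ) ^ (i + 1 + 1 + j) * ((i + 1 + 1 + j).choose j *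
    w (j + 1 + (i + 1 + 1)) * (a * 3 ^ m) ^ (i + 1 + 1)) with hS
  have hSd : (3 : ℤ) ^ (2 * m + e) ∣ S := by
    refine dvd_sum fun i _ => ?_
    have h : (3 : ℤ) ^ (2 * m + e) ∣ (i + 1 + 1 + j).choose j * (3 ^ m) ^ (i + 1 + 1) := by
      exact_mod_cast three_pow_dvd_choose_mul hm (i := i + 1 + 1) (by lia) he
    convert h.mul_left ((-1) ^ (i + 1 + 1 + j) * w (j + 1 + (i + 1 + 1)) * a ^ (i + 1 + 1)) using 1
    ring
  have hsign : (-1 : ℤ) ^ (L + 1) = -(-1) ^ j := by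
    have hodd' : Odd (L + 1 + j) := by
      rw [hL] at hodd
      rw [show L + 1 + 1 + (j + 1) = L + 1 + j + 2 by ring] at hodd
      exact (Nat.odd_add.1 hodd).2 even_two
    have h1 : (-1 : ℤ) ^ (L + 1) * (-1) ^ j = -1 := by rw [← pow_add, hodd'.neg_one_pow]
    have h2 : (-1 : ℤ) ^ j * (-1) ^ j = 1 := by rw [← mul_pow]; simp
    calc (-1 : ℤ) ^ (L + 1) = (-1) ^ (L + 1) * ((-1) ^ j * (-1) ^ j) := by rw [h2, mul_one]
      _ = _ := by rw [← mul_assoc, h1]; ring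
  have hch : ((0 + 1 + j).choose j : ℤ) = j + 1 := by
    rw [zero_add, add_comm, Nat.choose_succ_self_right]
    push_cast
    ring
  rw [hsign, hch] at hsw
  simp only [zero_add, Nat.choose_self, add_zero, pow_zero, pow_one, Nat.cast_one] at hsw
  have h2 : (-1 : ℤ) ^ j * (-1) ^ j = 1 := by rw [← mul_pow]; simp
  have : 2 * w (j + 1) - (j + 1) * (a * 3 ^ m) * w (j + 2) = -(-1) ^ j * S := by
    rw [show j + 1 + 1 = j + 2 by ring] at hsw
    linear_combination (-(-1) ^ j) * hsw -
      (2 * w (j + 1) - (j + 1) * (a * 3 ^ m) * w (j + 2)) * h2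
  rw [this]
  exact hSd.mul_left _

/-! ### Assembling the valuations -/

lemma padicValNat_three_eq_of_add_eq {a m j k : ℕ} (ha : a = 1 ∨ a = 2) (hj : 0 < j) (hk : 0 < k)
    (h : j + k = a * 3 ^ m) : padicValNat 3 j = padicValNat 3 k := by
  have : Fact (Nat.Prime 3) := ⟨Nat.prime_three⟩
  have key : ∀ {j k : ℕ}, 0 < j → 0 < k → j + k = a * 3 ^ m →
      padicValNat 3 j ≤ padicValNat 3 k := by
    intro j k hj hk h
    rw [← padicValNat_dvd_iff_le hk.ne']
    rcases Nat.lt_or_ge m (padicValNat 3 j) with hlt | hle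
    · have h1 : 3 ^ (m + 1) ≤ j :=
        Nat.le_of_dvd hj ((pow_dvd_pow 3 hlt).trans pow_padicValNat_dvd)
      rw [pow_succ] at h1
      rcases ha with rfl | rfl <;> lia
    · refine (Nat.dvd_add_right pow_padicValNat_dvd).1 ?_
      rw [h]
      exact (pow_dvd_pow 3 hle).mul_left a
  exact le_antisymm (key hj hk h) (key hk hj (by rw [add_comm, h]))

lemma padicValNat_three_add_of_scaled {k s t c b : ℕ} {w : ℤ} (hk : k ≠ 0)
    (h : 3 ^ t * (s : ℤ) = 3 ^ c * w) (hw : emultiplicity (3 : ℤ) (k * w) = b) :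
    s ≠ 0 ∧ padicValNat 3 k + padicValNat 3 s + t = c + b := by
  have : Fact (Nat.Prime 3) := ⟨Nat.prime_three⟩
  have hfin : FiniteMultiplicity (3 : ℤ) (k * w) := finiteMultiplicity_of_emultiplicity_eq_natCast hw
  have hs : s ≠ 0 := by
    rintro rfl
    have : w = 0 := by simpa using h.symm
    simp [this] at hw
  refine ⟨hs, ?_⟩
  have h' : (3 : ℤ) ^ t * ((k : ℤ) * s) = 3 ^ c * (k * w) := by linear_combination (k : ℤ) * h
  have he := congrArg (emultiplicity (3 : ℤ)) h'
  have h3 : Prime (3 : ℤ) := Int.prime_three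
  rw [emultiplicity_mul h3, emultiplicity_mul h3, emultiplicity_mul h3, hw,
    emultiplicity_pow_self h3.ne_zero h3.not_isUnit, emultiplicity_pow_self h3.ne_zero h3.not_isUnit,
    show (3 : ℤ) = ((3 : ℕ) : ℤ) by norm_num, Int.natCast_emultiplicity,
    Int.natCast_emultiplicity, ← padicValNat_eq_emultiplicity hk,
    ← padicValNat_eq_emultiplicity hs] at he
  have : t + (padicValNat 3 k + padicValNat 3 s) = c + b := by exact_mod_cast he
  lia

lemma emultiplicity_three_mul_scaled {a : ℕ} (ha : a = 1 ∨ a = 2) {M j k : ℕ} {e w : ℤ}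
    (he : IsUnit e)
    (hw : (3 : ℤ) ^ (M + 1) ∣ w - e * Nat.stirlingFirst (a * 3 ^ (M + 1)) j)
    (hk : Even k) (hk0 : 0 < k) (hk2 : k ≤ 2 * (a * 3 ^ M)) (hjk : j + k = a * 3 ^ (M + 1)) :
    emultiplicity (3 : ℤ) (k * w) = M := by
  obtain ⟨h1, h2⟩ := three_pow_dvd_mul_stirlingFirst ha M hk hk0 hk2 hjk
  set s : ℤ := (Nat.stirlingFirst (a * 3 ^ (M + 1)) j : ℤ)
  have hkw : (k : ℤ) * w = k * (w - e * s) + e * (k * s) := by ring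
  rw [emultiplicity_eq_coe, hkw]
  constructor
  · exact dvd_add (((pow_dvd_pow (3 : ℤ) (Nat.le_succ M)).trans hw).mul_left _) (h1.mul_left _)
  · rwa [dvd_add_right (hw.mul_left _), he.dvd_mul_left]

/-- The `3`-adic valuation of `s(a 3 ^ n, a 3 ^ m - k)`, with `n = m + r`, in subtraction-free
form. -/
lemma padicValNat_three_stirlingFirst {a M r j k : ℕ} (ha : a = 1 ∨ a = 2) (hj : 0 < j)
    (hk : 2 ≤ k) (hk2 : k ≤ 2 * (a * 3 ^ M) + 1) (hjk : j + k = a * 3 ^ (M + 1)) :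
    ∃ c, 2 * c + a * 3 ^ (M + 1) = a * 3 ^ (M + 1 + r) ∧
      Nat.stirlingFirst (a * 3 ^ (M + 1 + r)) j ≠ 0 ∧
      padicValNat 3 (k / 2) + padicValNat 3 (Nat.stirlingFirst (a * 3 ^ (M + 1 + r)) j) + r * j =
        c + M + (M + 1 + padicValNat 3 k) * parityBit k := by
  have : Fact (Nat.Prime 3) := ⟨Nat.prime_three⟩
  have h3 : Prime (3 : ℤ) := Int.prime_three
  obtain ⟨c, e, w, hc, he, hw⟩ := exists_scaled_stirlingFirst a (M + 1) r
  have hhalf : ∀ t : ℕ, t ≠ 0 → padicValNat 3 (2 * t) = padicValNat 3 t := fun t ht => by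
    rw [padicValNat.mul two_ne_zero ht, padicValNat.eq_zero_of_not_dvd (by norm_num), zero_add]
  refine ⟨c, hc, ?_⟩
  rcases Nat.even_or_odd' k with ⟨t, rfl | rfl⟩
  · have hev : Even (2 * t) := even_two_mul t
    have hm := emultiplicity_three_mul_scaled ha he (hw j).2 hev (by lia)
      -- Parity improves `k ≤ 2D + 1` to `k ≤ 2D`, the degree of `(1 - X²)^D`, where `D = a 3^M`.
      (by rcases Nat.lt_or_ge (2 * (a * 3 ^ M)) (2 * t) with h | h <;> lia) hjk
    obtain ⟨hs, hv⟩ := padicValNat_three_add_of_scaled (by lia) (hw j).1 hm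
    refine ⟨hs, ?_⟩
    rw [parityBit, if_pos hev, Nat.mul_div_cancel_left t two_pos, ← hhalf t (by lia), hv]
    simp
  · obtain ⟨j, rfl⟩ : ∃ b, j = b + 1 := ⟨j - 1, by lia⟩
    have hne : ¬ Even (2 * t + 1) := by simp
    have hm := emultiplicity_three_mul_scaled ha he (hw (j + 2)).2 (even_two_mul t) (by lia)
      (by lia) (by lia)
    have hodd : Odd (a * 3 ^ (M + 1 + r) + (j + 1)) := by
      have h1 : Odd ((j + 1) + a * 3 ^ (M + 1)) := by
        rw [← hjk]
        exact ⟨j + 1 + t, by ring⟩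
      rw [← hc, show 2 * c + a * 3 ^ (M + 1) + (j + 1) = (j + 1 + a * 3 ^ (M + 1)) + 2 * c by ring]
      exact h1.add_even (even_two_mul c)
    set f := padicValNat 3 (j + 1) with hf
    have hdvd := three_pow_dvd_two_mul_scaled_sub (m := M + 1) (by lia)
      (by rcases ha with rfl | rfl <;> lia) (fun i => (hw i).1) hodd
      (pow_padicValNat_dvd (p := 3) (n := j + 1))
    rw [← hf] at hdvd
    have hunit : ∀ x : ℕ, x = 1 ∨ x = 2 → emultiplicity (3 : ℤ) x = 0 := fun x hx => by
      rw [emultiplicity_eq_zero]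
      rcases hx with rfl | rfl <;> norm_num
    have hmain : emultiplicity (3 : ℤ)
        (a * ((j + 1 : ℕ) * (3 ^ (M + 1) * ((2 * t : ℕ) * w (j + 2))))) =
        (f + (M + 1 + M) : ℕ) := by
      rw [emultiplicity_mul h3, emultiplicity_mul h3, emultiplicity_mul h3, hm, hunit a ha,
        emultiplicity_pow_self h3.ne_zero h3.not_isUnit, zero_add,
        show (3 : ℤ) = ((3 : ℕ) : ℤ) by norm_num, Int.natCast_emultiplicity,
        ← padicValNat_eq_emultiplicity (by lia)]
      push_cast
      rfl
    -- The error has valuation at least `2M + 2 + f`, just one more than the `2M + 1 + f` of the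
    -- main term, so the latter decides.
    have hlt : emultiplicity (3 : ℤ)
        (a * ((j + 1 : ℕ) * (3 ^ (M + 1) * ((2 * t : ℕ) * w (j + 2))))) <
        emultiplicity (3 : ℤ) ((2 * t : ℕ) *
          (2 * w (j + 1) - (j + 1) * (a * 3 ^ (M + 1)) * w (j + 2))) := by
      rw [hmain]
      refine lt_of_lt_of_le ?_ (le_emultiplicity_of_pow_dvd (hdvd.mul_left _))
      exact_mod_cast (by lia : f + (M + 1 + M) < 2 * (M + 1) + f)
    have hsum := emultiplicity_add_of_gt hlt
    have hm' : emultiplicity (3 : ℤ) ((2 * t : ℕ) * w (j + 1)) = (f + (M + 1 + M) : ℕ) := by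
      rw [← hmain, ← hsum, ← zero_add (emultiplicity _ _), ← hunit 2 (Or.inr rfl),
        ← emultiplicity_mul h3]
      congr 1
      push_cast
      ring
    obtain ⟨hs, hv⟩ := padicValNat_three_add_of_scaled (by lia) (hw (j + 1)).1 hm'
    refine ⟨hs, ?_⟩
    have hfk := padicValNat_three_eq_of_add_eq ha (by lia) (by lia) hjk
    rw [parityBit, if_neg hne, show (2 * t + 1) / 2 = t by lia, ← hhalf t (by lia), hv, ← hfk]
    lia

lemma padicValNat_three_stirlingFirst_eq {a n m k : ℕ} (ha : a = 1 ∨ a = 2) (hm : 1 ≤ m)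
    (hmn : m ≤ n) (hk : 2 ≤ k) (hk2 : k ≤ 2 * a * 3 ^ (m - 1) + 1) (hkm : k < a * 3 ^ m) :
    Nat.stirlingFirst (a * 3 ^ n) (a * 3 ^ m - k) ≠ 0 ∧
      (padicValNat 3 (Nat.stirlingFirst (a * 3 ^ n) (a * 3 ^ m - k)) : ℚ) =
        (a : ℚ) / 2 * ((3 : ℚ) ^ n - (3 : ℚ) ^ m)
          - ((n : ℚ) - (m : ℚ)) * ((a : ℚ) * (3 : ℚ) ^ m - (k : ℚ))
          + (m : ℚ) - 1 - (padicValNat 3 (k / 2) : ℚ)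
          + ((m : ℚ) + (padicValNat 3 k : ℚ)) * (parityBit k : ℚ) := by
  obtain ⟨M, rfl⟩ : ∃ M, m = M + 1 := ⟨m - 1, by lia⟩
  obtain ⟨r, rfl⟩ : ∃ r, n = M + 1 + r := ⟨n - (M + 1), by lia⟩
  obtain ⟨j, hj⟩ : ∃ j, j + k = a * 3 ^ (M + 1) := ⟨a * 3 ^ (M + 1) - k, by lia⟩
  have hjs : a * 3 ^ (M + 1) - k = j := by lia
  rw [Nat.add_sub_cancel, mul_assoc] at hk2
  obtain ⟨c, hc, hs, hv⟩ := padicValNat_three_stirlingFirst (r := r) ha (by lia) hk hk2 hj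
  rw [hjs]
  refine ⟨hs, ?_⟩
  have hc' : (2 : ℚ) * c + a * 3 ^ (M + 1) = a * 3 ^ (M + 1 + r) := by exact_mod_cast hc
  have hj' : (j : ℚ) + k = a * 3 ^ (M + 1) := by exact_mod_cast hj
  have hv' := congrArg (Nat.cast : ℕ → ℚ) hv
  push_cast at hv' ⊢
  linear_combination hv' + (1 / 2 : ℚ) * hc' - (r : ℚ) * hj'

/-- For `p = 3` the congruence is modulo 2 and always holds, so no Bernoulli number occurs. -/
lemma hongQiuTerm_three (k : ℕ) : hongQiuTerm 3 k = -1 - (padicValNat 3 (k / 2) : ℤ) := by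
  rw [hongQiuTerm, if_pos]
  rcases Nat.even_or_odd k with h | h
  · rw [parityBit, if_pos h, Nat.ModEq, Nat.even_iff.1 h]
  · rw [parityBit, if_neg (Nat.not_even_iff_odd.2 h), Nat.ModEq, Nat.odd_iff.1 h]

theorem theorem1p1 :
    (∀ a n m k : ℕ, (a = 1 ∨ a = 2) → 1 ≤ m → m ≤ n →
      2 ≤ k → k ≤ 2 * a * 3 ^ (m - 1) + 1 → k < a * 3 ^ m →
      Nat.stirlingFirst (a * 3 ^ n) (a * 3 ^ m - k) ≠ 0 ∧
      (padicValNat 3 (Nat.stirlingFirst (a * 3 ^ n) (a * 3 ^ m - k)) : ℚ) =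
        (a : ℚ) / 2 * ((3 : ℚ) ^ n - (3 : ℚ) ^ m)
          - ((n : ℚ) - (m : ℚ)) * ((a : ℚ) * (3 : ℚ) ^ m - (k : ℚ))
          + (m : ℚ) - 1 - (padicValNat 3 (k / 2) : ℚ)
          + ((m : ℚ) + (padicValNat 3 k : ℚ)) * (parityBit k : ℚ)) ∧
    HongQiuConjecture 3 := by
  refine ⟨fun a n m k ha hm hmn hk hk2 hkm =>
    padicValNat_three_stirlingFirst_eq ha hm hmn hk hk2 hkm, ?_⟩
  intro a n m k ha1 ha2 hm hmn hk hk2 hkm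
  obtain ⟨hs, hv⟩ := padicValNat_three_stirlingFirst_eq (by lia) hm hmn hk
    (by rwa [mul_comm a] at hk2) hkm
  refine ⟨hs, ?_⟩
  rw [hv, hongQiuTerm_three]
  simp only [Int.cast_sub, Int.cast_neg, Int.cast_one, Int.cast_natCast, Nat.cast_ofNat]
  ring
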